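/- Let $H$ be a separable infinite-dimensional complex Hilbert space, let $X=(X_1,\dots,X_g)$ be a $g$-tuple of compact self-adjoint operators on $H$, and write $H_n=\mathbb{C}^n$ for $n\ge 1$. All operations on tuples are entrywise, e.g. $V^*YV=(V^*Y_1V,\dots,V^*Y_gV)$. The noncommutative convex hull of $X$ is $K_X=(K_X(n))_{n\ge 1}$, where $K_X(n)$ is the set of $g$-tuples $Y$ of self-adjoint operators on $H_n$ of the form $Y=V^*(I\otimes X)V$ for some isometry $V:H_n\to\bigoplus_1^\infty H$; here $I\otimes X_i$ applies $X_i$ to every summand. Assume: 1. every finite-dimensional reducing subspace of $X$ (a subspace $W\subseteq H$ such that $W$ and $W^\perp$ are invariant under every $X_i$) is $\{0\}$; 2. $0$ is in the finite interior of $K_X$, that is, there are an integer $d$ and a unit vector $v\in H^d$ with $\langle (I_d\otimes X_i)v,v\rangle=0$ for all $i=1,\dots,g$. A matrix convex combination of elements of a graded set $K=(K(n))_{n\ge 1}$ is a finite sum $\sum_{j=1}^k V_j^*Z^jV_j$ with $Z^j\in K(n_j)$, $V_j:H_n\to H_{n_j}$ linear and $\sum_{j=1}^k V_j^*V_j=I_n$;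 it is weakly proper if all $V_j\ne 0$. Then: 1. $K_X$ is matrix convex, i.e. closed under matrix convex combinations; 2. $K_X$ is closed, i.e. every $K_X(n)$ is closed; 3. $K_X$ is bounded, i.e. there is a constant $C>0$ such that $C\,I_n-\sum_{i=1}^g Y_i^2$ is positive semidefinite for all $n\ge 1$ and all $Y\in K_X(n)$; 4. $K_X$ has no absolute extreme points: there are no $n\ge 1$ and $Y\in K_X(n)$ such that, whenever $Y=\sum_{j=1}^k V_j^*Z^jV_j$ is a weakly proper matrix convex combination of elements $Z^j\in K_X(n_j)$, then for every $j$ either $n_j=n$ and $Y$ is unitarily equivalent to $Z^j$, or $n_j>n$ and there is an $A\in K_X(m)$, for some $m\ge 1$, such that $Y\oplus A$ is unitarily equivalent to $Z^j$. -/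

import Mathlib

open scoped ENNReal

noncomputable section

namespace MatConv

/-- The Hilbert space direct sum of copies of `H` indexed by `ι`. For `ι = Fin d` it is `H ^ d`,
for `ι = ℕ` it is the direct sum of countably many copies of `H`. -/
abbrev Copies (ι : Type*) (H : Type*) [NormedAddCommGroup H] : Type _ :=
  lp (fun _ : ι => H) 2

section Operators

variable {H : Type*} [NormedAddCommGroup H] [InnerProductSpace ℂ H]

theorem memLp_map {ι : Type*} (T : H →L[ℂ] H) {f : ι → H} (hf : Memℓp f 2) :
    Memℓp (fun j => T (f j)) 2 :=
  (hf.const_smul ((‖T‖ : ℝ) : ℂ)).mono' fun j => by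
    have h := T.le_opNorm (f j)
    simpa [norm_smul] using h

/-- The operator `I ⊗ T` on a direct sum of copies of `H`, which applies `T` to every summand. -/
def ampl (ι : Type*) (T : H →L[ℂ] H) : Copies ι H →L[ℂ] Copies ι H :=
  LinearMap.mkContinuous
    { toFun := fun f => ⟨fun j => T (f j), memLp_map T (lp.memℓp f)⟩
      map_add' := fun f f' => lp.ext <| funext fun j => map_add T (f j) (f' j)
      map_smul' := fun c f => lp.ext <| funext fun j => map_smul T c (f j) }
    ‖T‖ (fun f => by
      have h2 : (0 : ℝ) < (2 : ℝ≥0∞).toReal := by norm_num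
      refine lp.norm_le_of_forall_sum_le h2 (by positivity) fun s => ?_
      calc ∑ j ∈ s, ‖T (f j)‖ ^ (2 : ℝ≥0∞).toReal
          ≤ ∑ j ∈ s, ‖T‖ ^ (2 : ℝ≥0∞).toReal * ‖f j‖ ^ (2 : ℝ≥0∞).toReal := by
            refine Finset.sum_le_sum fun j _ => ?_
            rw [← Real.mul_rpow (norm_nonneg _) (norm_nonneg _)]
            exact Real.rpow_le_rpow (norm_nonneg _) (T.le_opNorm _) h2.le
        _ = ‖T‖ ^ (2 : ℝ≥0∞).toReal * ∑ j ∈ s, ‖f j‖ ^ (2 : ℝ≥0∞).toReal := by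
            rw [Finset.mul_sum]
        _ ≤ ‖T‖ ^ (2 : ℝ≥0∞).toReal * ‖f‖ ^ (2 : ℝ≥0∞).toReal := by
            gcongr
            exact lp.sum_rpow_le_norm_rpow h2 f s
        _ = (‖T‖ * ‖f‖) ^ (2 : ℝ≥0∞).toReal := by
            rw [Real.mul_rpow (norm_nonneg _) (norm_nonneg _)])

theorem ampl_apply (ι : Type*) (T : H →L[ℂ] H) (f : Copies ι H) (j : ι) :
    ampl ι T f j = T (f j) := rfl

/-- A closed subspace `W` reduces the tuple `X` if `W` and its orthogonal complement are
invariant under every entry of `X`. -/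
def IsReducing {g : ℕ} (X : Fin g → H →L[ℂ] H) (W : Submodule ℂ H) : Prop :=
  IsClosed (W : Set H) ∧
    ∀ i, (∀ w ∈ W, X i w ∈ W) ∧ (∀ w ∈ Wᗮ, X i w ∈ Wᗮ)

/-- The finite dimensional reducing subspaces of `X` are trivial. -/
def NoFiniteDimReducing {g : ℕ} (X : Fin g → H →L[ℂ] H) : Prop :=
  ∀ W : Submodule ℂ H, IsReducing X W → FiniteDimensional ℂ W → W = ⊥

/-- Zero is in the finite interior of the noncommutative convex hull of `X`: there are `d` and a
unit vector `v` in `H ^ d` with `v* (I ⊗ X i) v = 0` for every `i`. -/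
def ZeroInFiniteInterior {g : ℕ} (X : Fin g → H →L[ℂ] H) : Prop :=
  ∃ (d : ℕ) (v : Copies (Fin d) H), ‖v‖ = 1 ∧ ∀ i, inner ℂ v (ampl (Fin d) (X i) v) = 0

end Operators

section DirectSum

variable {M N : Type*} [NormedAddCommGroup M] [InnerProductSpace ℂ M]
  [NormedAddCommGroup N] [InnerProductSpace ℂ N]

/-- The direct sum of two operators, on the Hilbert space direct sum. -/
def opSum (S : M →L[ℂ] M) (T : N →L[ℂ] N) : WithLp 2 (M × N) →L[ℂ] WithLp 2 (M × N) :=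
  (WithLp.prodContinuousLinearEquiv 2 ℂ M N).symm.toContinuousLinearMap ∘L
    (S.prodMap T) ∘L (WithLp.prodContinuousLinearEquiv 2 ℂ M N).toContinuousLinearMap

/-- Unitary equivalence of tuples of operators. -/
def UnitarilyEquiv {g : ℕ} (Y : Fin g → M →L[ℂ] M) (Z : Fin g → N →L[ℂ] N) : Prop :=
  ∃ U : M ≃ₗᵢ[ℂ] N, ∀ i x, U (Y i x) = Z i (U x)

end DirectSum

/-- The standard Hilbert space of dimension `n`, where `n` is a positive integer. -/
abbrev Hn (n : ℕ+) : Type := EuclideanSpace ℂ (Fin (n : ℕ))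

/-- `g`-tuples of operators on the `n`-dimensional Hilbert space. -/
abbrev Tup (g : ℕ) (n : ℕ+) : Type := Fin g → Hn n →L[ℂ] Hn n

/-- A graded set, with one set of `g`-tuples in every dimension. -/
abbrev NCSet (g : ℕ) : Type := (n : ℕ+) → Set (Tup g n)

/-- The matrix combination `∑ j, (V j)* (Y j) (V j)`. -/
def combination {g k : ℕ} {n : ℕ+} {s : Fin k → ℕ+} (V : (j : Fin k) → Hn n →L[ℂ] Hn (s j))
    (Y : (j : Fin k) → Tup g (s j)) : Tup g n :=
  fun i => ∑ j, ContinuousLinearMap.adjoint (V j) ∘L Y j i ∘L V j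

/-- The normalization `∑ j, (V j)* (V j) = I` of a matrix convex combination. -/
def IsConvexWeight {k : ℕ} {n : ℕ+} {s : Fin k → ℕ+} (V : (j : Fin k) → Hn n →L[ℂ] Hn (s j)) :
    Prop :=
  ∑ j, ContinuousLinearMap.adjoint (V j) ∘L V j = ContinuousLinearMap.id ℂ (Hn n)

/-- A graded set is matrix convex if it consists of self-adjoint tuples and is closed under matrix
convex combinations. -/
def IsMatrixConvex {g : ℕ} (K : NCSet g) : Prop :=
  (∀ n, ∀ Y ∈ K n, ∀ i, IsSelfAdjoint (Y i)) ∧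
    ∀ (n : ℕ+) (k : ℕ) (s : Fin k → ℕ+) (V : (j : Fin k) → Hn n →L[ℂ] Hn (s j))
      (Y : (j : Fin k) → Tup g (s j)),
      (∀ j, Y j ∈ K (s j)) → IsConvexWeight V → combination V Y ∈ K n

/-- A graded set is closed if all its levels are closed. -/
def IsClosedNC {g : ℕ} (K : NCSet g) : Prop :=
  ∀ n, IsClosed (K n)

/-- A graded set is bounded if there is one constant `C > 0` such that `C - ∑ i, (Y i)²` is
positive semidefinite for all its elements `Y`, in all dimensions. -/
def IsBoundedNC {g : ℕ} (K : NCSet g) : Prop :=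
  ∃ C : ℝ, 0 < C ∧ ∀ n, ∀ Y ∈ K n,
    ((C : ℂ) • ContinuousLinearMap.id ℂ (Hn n) - ∑ i, Y i ∘L Y i).IsPositive

/-- The absolute extreme points of `K` at level `n`. -/
def absExtreme {g : ℕ} (K : NCSet g) (n : ℕ+) : Set (Tup g n) :=
  {Y | Y ∈ K n ∧
    ∀ (k : ℕ) (s : Fin k → ℕ+) (V : (j : Fin k) → Hn n →L[ℂ] Hn (s j))
      (Z : (j : Fin k) → Tup g (s j)),
      (∀ j, Z j ∈ K (s j)) → (∀ j, V j ≠ 0) → IsConvexWeight V → Y = combination V Z →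
      ∀ j, (s j = n ∧ UnitarilyEquiv Y (Z j)) ∨
        (n < s j ∧ ∃ (m : ℕ+) (A : Tup g m), A ∈ K m ∧
          UnitarilyEquiv (fun i => opSum (Y i) (A i)) (Z j))}

/-- The noncommutative convex hull of a tuple `X` of self-adjoint operators on `H`. Its elements
of level `n` are the compressions `V* (I ⊗ X) V`, where `V` is an isometry into the direct sum of
countably many copies of `H`. -/
def ncHull {H : Type*} [NormedAddCommGroup H] [InnerProductSpace ℂ H] [CompleteSpace H] {g : ℕ}
    (X : Fin g → H →L[ℂ] H) : NCSet g :=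
  fun n => {Y | (∀ i, IsSelfAdjoint (Y i)) ∧
    ∃ V : Hn n →L[ℂ] Copies ℕ H, Isometry V ∧
      ∀ i, Y i = ContinuousLinearMap.adjoint V ∘L ampl ℕ (X i) ∘L V}

end MatConv

end

namespace MatConv

/-! A point of the hull is `Y = ∑ w_j* X w_j` with `∑ w_j* w_j = I`, the `w_j` being the coordinates
of the isometry (`IsKraus`). Matrix convexity follows by composing such families with the `V_j`,
boundedness from `‖Y_i‖ ≤ ‖X_i‖`.

No absolute extreme points: adjoin to the range of `V` a unit vector `u` orthogonal to it. The
larger compression `Z` dilates `Y`, so extremality makes `Z` unitarily equivalent to `Y ⊕ A` with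
`A` of size one. Comparing the traces of `Z_i` and `Z_i²` with those of `Y_i ⊕ A_i` kills the
off-diagonal entries of `Z_i` (`inner_ampl_eq_zero_of_mem_absExtreme`). Hence the range of `V` is
invariant under `I ⊗ X`; its coordinate projections to `H` are finite-dimensional and reducing, so
zero, and `V = 0`.

Closedness: points of the hull come from functionals on the operators on `H^n` forming a weak-*
compact set. A weak-* limit may lose mass, so on compact operators it only yields a family with `∑
w_j* w_j ≤ I`; the vector with vanishing compression fills the defect (`mem_ncHull_of_contraction`).
Thus each level is the projection of a closed set along a compact factor. -/

theorem hasSum_prod_of_fintype {κ ι α : Type*} [Fintype κ] [AddCommMonoid α] [TopologicalSpace α]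
    [ContinuousAdd α] {f : κ → ι → α} {a : κ → α} (h : ∀ k, HasSum (f k) (a k)) :
    HasSum (fun p : κ × ι => f p.1 p.2) (∑ k, a k) := by
  classical
  have h1 : ∀ k, HasSum (fun p : κ × ι => if p.1 = k then f p.1 p.2 else 0) (a k) := by
    intro k
    have hinj : Function.Injective (Prod.mk k : ι → κ × ι) := fun x y hxy => (Prod.mk.inj hxy).2
    rw [← hinj.hasSum_iff]
    · simpa [Function.comp_def] using h k
    · rintro ⟨k', j⟩ hp
      have : k' ≠ k := by
        rintro rfl
        exact hp ⟨j, rfl⟩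
      simp [this]
  have h2 := hasSum_sum (s := Finset.univ) fun k _ => h1 k
  simpa using h2

/-! ### Coordinate families of isometries; matrix convexity and boundedness. -/

section Kraus

variable {H : Type*} [NormedAddCommGroup H] [InnerProductSpace ℂ H]

/-- The family `w` consists of the components of an isometry `W` with `Y = W* (I ⊗ X) W`. -/
structure IsKraus {g : ℕ} {n : ℕ+} {ι : Type*} (X : Fin g → H →L[ℂ] H) (w : ι → Hn n →L[ℂ] H)
    (Y : Tup g n) : Prop where
  hasSum_norm_sq : ∀ x, HasSum (fun j => ‖w j x‖ ^ 2) (‖x‖ ^ 2)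
  hasSum_inner : ∀ i x, HasSum (fun j => inner ℂ (w j x) (X i (w j x))) (inner ℂ x (Y i x))

theorem hasSum_norm_sq_copies {ι H : Type*} [NormedAddCommGroup H] (f : Copies ι H) :
    HasSum (fun j => ‖f j‖ ^ 2) (‖f‖ ^ 2) := by
  have h := lp.hasSum_norm (by norm_num : 0 < (2 : ℝ≥0∞).toReal) f
  simpa using h

theorem hasSum_inner_ampl {ι : Type*} (T : H →L[ℂ] H) (f : Copies ι H) :
    HasSum (fun j => inner ℂ (f j) (T (f j))) (inner ℂ f (ampl ι T f)) :=
  lp.hasSum_inner f (ampl ι T f)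

/-- Evaluation of a family at an index, as a linear map. -/
def coordₗ {ι : Type*} (j : ι) : Copies ι H →ₗ[ℂ] H where
  toFun f := f j
  map_add' _ _ := rfl
  map_smul' _ _ := rfl

/-- A square summable family of linear maps defines a map into the direct sum. -/
def stack {M ι : Type*} [AddCommGroup M] [Module ℂ M] (w : ι → M →ₗ[ℂ] H)
    (hw : ∀ x, Summable fun j => ‖w j x‖ ^ 2) : M →ₗ[ℂ] Copies ι H where
  toFun x := ⟨fun j => w j x, (memℓp_gen_iff (by norm_num)).2 (by simpa using hw x)⟩
  map_add' x y := lp.ext <| funext fun j => map_add (w j) x y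
  map_smul' c x := lp.ext <| funext fun j => map_smul (w j) c x

variable [CompleteSpace H] {g : ℕ} {n : ℕ+} {X : Fin g → H →L[ℂ] H}

theorem exists_isKraus_of_mem_ncHull {Y : Tup g n} (hY : Y ∈ ncHull X n) :
    ∃ w : ℕ → Hn n →L[ℂ] H, IsKraus X w Y := by
  obtain ⟨-, V, hV, hYV⟩ := hY
  have hnorm : ∀ x, ‖V x‖ = ‖x‖ := fun x =>
    (AddMonoidHomClass.isometry_iff_norm V).1 hV x
  refine ⟨fun j => LinearMap.toContinuousLinearMap (coordₗ j ∘ₗ V.toLinearMap), fun x => ?_,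
    fun i x => ?_⟩
  · rw [← hnorm]
    exact hasSum_norm_sq_copies (V x)
  · rw [hYV]
    simp only [ContinuousLinearMap.comp_apply, ContinuousLinearMap.adjoint_inner_right]
    exact hasSum_inner_ampl (X i) (V x)

theorem IsKraus.isSelfAdjoint {ι : Type*} {w : ι → Hn n →L[ℂ] H} {Y : Tup g n}
    (h : IsKraus X w Y) (hsa : ∀ i, IsSelfAdjoint (X i)) (i : Fin g) : IsSelfAdjoint (Y i) := by
  rw [ContinuousLinearMap.isSelfAdjoint_iff_isSymmetric, LinearMap.isSymmetric_iff_inner_map_self_real]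
  intro x
  have h1 := h.hasSum_inner i x
  have h2 := h1.star
  have h3 : (fun j => star (inner ℂ (w j x) (X i (w j x)))) =
      fun j => inner ℂ (w j x) (X i (w j x)) := by
    funext j
    have := (ContinuousLinearMap.isSelfAdjoint_iff_isSymmetric.1 (hsa i)) (w j x) (w j x)
    simpa using this
  rw [h3] at h2
  have h4 := h2.unique h1
  simp only [ContinuousLinearMap.coe_coe]
  simpa using h4.symm

theorem IsKraus.mem_ncHull_nat {w : ℕ → Hn n →L[ℂ] H} {Y : Tup g n} (h : IsKraus X w Y)
    (hsa : ∀ i, IsSelfAdjoint (X i)) : Y ∈ ncHull X n := by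
  set V : Hn n →L[ℂ] Copies ℕ H := LinearMap.toContinuousLinearMap
    (stack (fun j => (w j).toLinearMap) fun x => (h.hasSum_norm_sq x).summable) with hVdef
  have hV : ∀ x j, V x j = w j x := fun x j => rfl
  refine ⟨h.isSelfAdjoint hsa, V, ?_, fun i => ?_⟩
  · refine (AddMonoidHomClass.isometry_iff_norm V).2 fun x => ?_
    have h1 := (hasSum_norm_sq_copies (V x)).unique (h.hasSum_norm_sq x)
    exact (sq_eq_sq₀ (norm_nonneg _) (norm_nonneg _)).1 h1
  · apply ContinuousLinearMap.coe_injective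
    -- Over `ℂ` an operator is determined by its quadratic form, which is all that `IsKraus`
    -- records.
    rw [← ext_inner_map]
    intro x
    have h1 := (hasSum_inner_ampl (X i) (V x)).unique (h.hasSum_inner i x)
    rw [← inner_conj_symm, ← inner_conj_symm (_ : Hn n) x]
    congr 1
    rw [ContinuousLinearMap.coe_coe, ← h1]
    simp [ContinuousLinearMap.adjoint_inner_right]

/-- Any index type will do: a summable family has countable support, and testing on the finitely
many basis vectors shows that only countably many `w j` are nonzero. These are re-indexed by `ℕ` and
padded with zeros. -/
theorem IsKraus.mem_ncHull {ι : Type*} {w : ι → Hn n →L[ℂ] H} {Y : Tup g n} (h : IsKraus X w Y)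
    (hsa : ∀ i, IsSelfAdjoint (X i)) : Y ∈ ncHull X n := by
  let s : Set ι := ⋃ a, Function.support fun j => ‖w j (EuclideanSpace.single a 1)‖ ^ 2
  have hs : s.Countable := Set.countable_iUnion fun a =>
    (h.hasSum_norm_sq (EuclideanSpace.single a 1)).summable.countable_support
  have hws : ∀ j ∉ s, w j = 0 := by
    intro j hj
    apply ContinuousLinearMap.coe_injective
    refine (EuclideanSpace.basisFun (Fin n) ℂ).toBasis.ext fun a => ?_
    have h1 : j ∉ Function.support fun j => ‖w j (EuclideanSpace.single a 1)‖ ^ 2 := fun h2 =>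
      hj (Set.mem_iUnion_of_mem a h2)
    simpa using h1
  have : Countable s := hs.to_subtype
  obtain ⟨f, hf⟩ := Countable.exists_injective_nat s
  let v : ℕ → Hn n →L[ℂ] H := Function.extend f (fun j : s => w j) 0
  have hvf : ∀ j, v (f j) = w j := fun j => hf.extend_apply _ _ _
  have hz : ∀ j ∉ Set.range f, v j = 0 := fun j hj => by
    simp only [v]
    rw [Function.extend_apply' _ _ _ (by simpa using hj)]
    rfl
  have hv : ∀ {α : Type} [AddCommMonoid α] [TopologicalSpace α] (q : (Hn n →L[ℂ] H) → α) (a : α),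
      q 0 = 0 → HasSum (fun j => q (w j)) a → HasSum (fun j => q (v j)) a := by
    intro α _ _ q a hq ha
    rw [← hf.hasSum_iff fun j hj => by rw [hz j hj, hq]]
    simp only [Function.comp_def, hvf]
    exact (hasSum_subtype_iff_of_support_subset (f := fun j => q (w j)) fun j hj => by
      by_contra hjs
      exact hj (by simp [hws j hjs, hq])).2 ha
  refine IsKraus.mem_ncHull_nat (w := v) ⟨fun x => ?_, fun i x => ?_⟩ hsa
  · exact hv (fun T => ‖T x‖ ^ 2) _ (by simp) (h.hasSum_norm_sq x)
  · exact hv (fun T => inner ℂ (T x) (X i (T x))) _ (by simp) (h.hasSum_inner i x)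

theorem isMatrixConvex_ncHull (hsa : ∀ i, IsSelfAdjoint (X i)) : IsMatrixConvex (ncHull X) := by
  refine ⟨fun n Y hY => hY.1, fun n k s V Y hY hV => ?_⟩
  choose w hw using fun j => exists_isKraus_of_mem_ncHull (hY j)
  refine IsKraus.mem_ncHull (ι := Fin k × ℕ) (w := fun p => w p.1 p.2 ∘L V p.1)
    ⟨fun x => ?_, fun i x => ?_⟩ hsa
  · have h1 := hasSum_prod_of_fintype fun j => (hw j).hasSum_norm_sq (V j x)
    have h2 : ∑ j, ‖V j x‖ ^ 2 = ‖x‖ ^ 2 := by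
      have h3 : inner ℂ x ((∑ j, ContinuousLinearMap.adjoint (V j) ∘L V j) x) = inner ℂ x x := by
        rw [hV]; rfl
      simp only [sum_apply, inner_sum, ContinuousLinearMap.comp_apply,
        ContinuousLinearMap.adjoint_inner_right, inner_self_eq_norm_sq_to_K] at h3
      exact_mod_cast h3
    rw [h2] at h1
    exact h1
  · have h1 := hasSum_prod_of_fintype fun j => (hw j).hasSum_inner i (V j x)
    have h2 : inner ℂ x (combination V Y i x) = ∑ j, inner ℂ (V j x) (Y j i (V j x)) := by
      simp [combination, ContinuousLinearMap.adjoint_inner_right]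
    rw [h2]
    exact h1

theorem norm_apply_le_of_mem_ncHull {Y : Tup g n} (hY : Y ∈ ncHull X n) (i : Fin g) (x : Hn n) :
    ‖Y i x‖ ≤ ‖X i‖ * ‖x‖ := by
  obtain ⟨-, V, hV, hYV⟩ := hY
  have hnorm : ∀ x, ‖V x‖ = ‖x‖ := fun x =>
    (AddMonoidHomClass.isometry_iff_norm V).1 hV x
  have hV1 : ‖V‖ ≤ 1 := V.opNorm_le_bound zero_le_one fun x => by rw [hnorm, one_mul]
  rw [hYV, ContinuousLinearMap.comp_apply, ContinuousLinearMap.comp_apply]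
  calc _ ≤ ‖ContinuousLinearMap.adjoint V‖ * ‖ampl ℕ (X i) (V x)‖ :=
        ContinuousLinearMap.le_opNorm _ _
    _ ≤ 1 * ‖ampl ℕ (X i) (V x)‖ := by
        gcongr
        rwa [LinearIsometryEquiv.norm_map]
    _ ≤ 1 * (‖X i‖ * ‖V x‖) := by
        gcongr
        exact ContinuousLinearMap.le_of_opNorm_le _
          (LinearMap.mkContinuous_norm_le _ (norm_nonneg _) _) _
    _ = ‖X i‖ * ‖x‖ := by rw [hnorm, one_mul]

theorem isBoundedNC_ncHull : IsBoundedNC (ncHull X) := by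
  -- The summand 1 only serves to make the constant strictly positive.
  refine ⟨1 + ∑ i, ‖X i‖ ^ 2, by positivity, fun n Y hY => ?_⟩
  rw [ContinuousLinearMap.isPositive_iff_complex]
  intro x
  have h1 : inner ℂ (((((1 + ∑ i, ‖X i‖ ^ 2 : ℝ)) : ℂ) • ContinuousLinearMap.id ℂ (Hn n) -
      ∑ i, Y i ∘L Y i) x) x =
      (((1 + ∑ i, ‖X i‖ ^ 2) * ‖x‖ ^ 2 - ∑ i, ‖Y i x‖ ^ 2 : ℝ) : ℂ) := by
    have h2 : ∀ i, inner ℂ (Y i (Y i x)) x = ((‖Y i x‖ : ℂ)) ^ 2 := fun i => by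
      refine ((ContinuousLinearMap.isSelfAdjoint_iff_isSymmetric.1 (hY.1 i)) (Y i x) x).trans ?_
      exact inner_self_eq_norm_sq_to_K (𝕜 := ℂ) (Y i x)
    simp only [sub_apply, smul_apply,
      ContinuousLinearMap.id_apply, sum_apply, inner_sub_left, inner_smul_left,
      sum_inner, ContinuousLinearMap.comp_apply, h2, inner_self_eq_norm_sq_to_K, Complex.conj_ofReal]
    push_cast
    rfl
  rw [h1]
  refine ⟨rfl, ?_⟩
  have h3 : ∑ i, ‖Y i x‖ ^ 2 ≤ ∑ i, (‖X i‖ ^ 2 * ‖x‖ ^ 2) := Finset.sum_le_sum fun i _ => by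
    rw [← mul_pow]
    exact pow_le_pow_left₀ (norm_nonneg _) (norm_apply_le_of_mem_ncHull hY i x) 2
  rw [← Finset.sum_mul] at h3
  have h4 := sq_nonneg ‖x‖
  simp only [RCLike.re_to_complex, Complex.ofReal_re]
  linarith

end Kraus

/-! ### Traces of squares and of direct sums. -/

section Trace

/-- The sum of the squared entries of a self-adjoint operator is the trace of its square. -/
theorem trace_comp_self_eq_sum {ι E : Type*} [Fintype ι] [NormedAddCommGroup E]
    [InnerProductSpace ℂ E] [CompleteSpace E] (b : OrthonormalBasis ι ℂ E) {T : E →L[ℂ] E}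
    (hT : IsSelfAdjoint T) :
    LinearMap.trace ℂ E (T.toLinearMap ∘ₗ T.toLinearMap) =
      ((∑ a, ∑ c, ‖inner ℂ (b c) (T (b a))‖ ^ 2 : ℝ) : ℂ) := by
  rw [LinearMap.trace_eq_sum_inner _ b]
  push_cast
  refine Finset.sum_congr rfl fun a _ => ?_
  have h1 : inner ℂ (b a) ((T.toLinearMap ∘ₗ T.toLinearMap) (b a)) = inner ℂ (T (b a)) (T (b a)) :=
    (ContinuousLinearMap.isSelfAdjoint_iff_isSymmetric.1 hT (b a) (T (b a))).symm
  refine h1.trans ((inner_self_eq_norm_sq_to_K (𝕜 := ℂ) (T (b a))).trans ?_)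
  rw [← RCLike.ofReal_pow, ← b.sum_sq_norm_inner_right (T (b a))]
  simp

theorem trace_conj_linearEquiv {M N : Type*} [AddCommGroup M] [Module ℂ M] [AddCommGroup N]
    [Module ℂ N] (e : M ≃ₗ[ℂ] N) {S : M →ₗ[ℂ] M} {T : N →ₗ[ℂ] N} (h : ∀ x, e (S x) = T (e x)) :
    LinearMap.trace ℂ N T = LinearMap.trace ℂ M S := by
  have : T = e.conj S := by
    ext y
    simp [LinearEquiv.conj_apply, h]
  rw [this, LinearMap.trace_conj']

/-- The trace is additive on direct sums, up to unitary equivalence. -/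
theorem trace_eq_add_of_unitary {M N L : Type*} [NormedAddCommGroup M] [InnerProductSpace ℂ M]
    [NormedAddCommGroup N] [InnerProductSpace ℂ N] [NormedAddCommGroup L] [InnerProductSpace ℂ L]
    [FiniteDimensional ℂ M] [FiniteDimensional ℂ N]
    (U : WithLp 2 (M × N) ≃ₗᵢ[ℂ] L) {S : M →ₗ[ℂ] M} {T : N →ₗ[ℂ] N} {R : L →ₗ[ℂ] L}
    (h : ∀ x y, U (WithLp.toLp 2 (S x, T y)) = R (U (WithLp.toLp 2 (x, y)))) :
    LinearMap.trace ℂ L R = LinearMap.trace ℂ M S + LinearMap.trace ℂ N T := by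
  rw [← LinearMap.trace_prodMap']
  exact trace_conj_linearEquiv ((WithLp.linearEquiv 2 ℂ (M × N)).symm ≪≫ₗ U.toLinearEquiv)
    fun x => h x.1 x.2

end Trace

/-! ### Absence of absolute extreme points. -/

section Extreme

variable {H : Type*} [NormedAddCommGroup H] [InnerProductSpace ℂ H]

/-- The extension of a linear map on `ℂ ^ n` to `ℂ ^ (n + 1)` sending the last basis vector to
`u`. -/
def snocMap {E : Type*} [AddCommGroup E] [Module ℂ E] {n : ℕ}
    (V : EuclideanSpace ℂ (Fin n) →ₗ[ℂ] E) (u : E) : EuclideanSpace ℂ (Fin (n + 1)) →ₗ[ℂ] E where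
  toFun x := V (WithLp.toLp 2 fun a => x a.castSucc) + x (Fin.last n) • u
  map_add' x y := by
    have : (WithLp.toLp 2 fun a : Fin n => (x + y) a.castSucc) =
        (WithLp.toLp 2 fun a : Fin n => x a.castSucc) + WithLp.toLp 2 fun a => y a.castSucc := rfl
    rw [this, map_add, PiLp.add_apply, add_smul]
    abel
  map_smul' c x := by
    have : (WithLp.toLp 2 fun a : Fin n => (c • x) a.castSucc) =
        c • (WithLp.toLp 2 fun a : Fin n => x a.castSucc) := rfl
    rw [this, map_smul, PiLp.smul_apply, smul_eq_mul, mul_smul, ← smul_add, RingHom.id_apply]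

/-- The inclusion of `ℂ ^ n` into `ℂ ^ (n + 1)` as the span of the first basis vectors. -/
def castSuccMap (n : ℕ) : EuclideanSpace ℂ (Fin n) →ₗ[ℂ] EuclideanSpace ℂ (Fin (n + 1)) where
  toFun x := WithLp.toLp 2 (Fin.snoc (α := fun _ => ℂ) x 0)
  map_add' x y := by
    ext a
    refine Fin.lastCases ?_ (fun a => ?_) a <;> simp
  map_smul' c x := by
    ext a
    refine Fin.lastCases ?_ (fun a => ?_) a <;> simp

theorem castSuccMap_castSucc {n : ℕ} (x : EuclideanSpace ℂ (Fin n)) (a : Fin n) :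
    castSuccMap n x a.castSucc = x a := by
  simp [castSuccMap]

theorem castSuccMap_last {n : ℕ} (x : EuclideanSpace ℂ (Fin n)) :
    castSuccMap n x (Fin.last n) = 0 := by
  simp [castSuccMap]

theorem norm_castSuccMap {n : ℕ} (x : EuclideanSpace ℂ (Fin n)) : ‖castSuccMap n x‖ = ‖x‖ := by
  simp [EuclideanSpace.norm_eq, Fin.sum_univ_castSucc, castSuccMap_castSucc, castSuccMap_last]

theorem castSuccMap_single {n : ℕ} (a : Fin n) :
    castSuccMap n (EuclideanSpace.single a 1) = EuclideanSpace.single a.castSucc 1 := by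
  ext b
  refine Fin.lastCases ?_ (fun b => ?_) b
  · rw [castSuccMap_last]
    simp [(Fin.castSucc_lt_last a).ne']
  · simp [castSuccMap_castSucc]

theorem snocMap_castSuccMap {E : Type*} [AddCommGroup E] [Module ℂ E] {n : ℕ}
    (V : EuclideanSpace ℂ (Fin n) →ₗ[ℂ] E) (u : E) (x : EuclideanSpace ℂ (Fin n)) :
    snocMap V u (castSuccMap n x) = V x := by
  simp only [snocMap, LinearMap.coe_mk, AddHom.coe_mk, castSuccMap_castSucc, castSuccMap_last]
  simp

theorem snocMap_single_last {E : Type*} [AddCommGroup E] [Module ℂ E] {n : ℕ}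
    (V : EuclideanSpace ℂ (Fin n) →ₗ[ℂ] E) (u : E) :
    snocMap V u (EuclideanSpace.single (Fin.last n) 1) = u := by
  have : (WithLp.toLp 2 fun a : Fin n =>
      (EuclideanSpace.single (Fin.last n) (1 : ℂ)) a.castSucc) = 0 := by
    ext a
    simp [(Fin.castSucc_lt_last a).ne]
  simp only [snocMap, LinearMap.coe_mk, AddHom.coe_mk, this]
  simp

theorem norm_snocMap {E : Type*} [NormedAddCommGroup E] [InnerProductSpace ℂ E] {n : ℕ}
    {V : EuclideanSpace ℂ (Fin n) →ₗ[ℂ] E} (hV : ∀ x, ‖V x‖ = ‖x‖) {u : E} (hu : ‖u‖ = 1)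
    (hVu : ∀ x, inner ℂ (V x) u = 0) (x : EuclideanSpace ℂ (Fin (n + 1))) :
    ‖snocMap V u x‖ = ‖x‖ := by
  rw [← sq_eq_sq₀ (norm_nonneg _) (norm_nonneg _), EuclideanSpace.norm_sq_eq,
    Fin.sum_univ_castSucc]
  simp only [snocMap, LinearMap.coe_mk, AddHom.coe_mk]
  rw [sq, norm_add_sq_eq_norm_sq_add_norm_sq_of_inner_eq_zero _ _
    (by rw [inner_smul_right, hVu, mul_zero]), ← sq, ← sq, hV, norm_smul, hu, mul_one,
    EuclideanSpace.norm_sq_eq]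

variable [CompleteSpace H] {g : ℕ} {n : ℕ+} {X : Fin g → H →L[ℂ] H}

/-- The compression of `I ⊗ X` to the range of an isometry belongs to the hull. -/
theorem compression_mem_ncHull (hsa : ∀ i, IsSelfAdjoint (X i)) {V : Hn n →L[ℂ] Copies ℕ H}
    (hV : Isometry V) :
    (fun i => ContinuousLinearMap.adjoint V ∘L ampl ℕ (X i) ∘L V) ∈ ncHull X n := by
  refine ⟨fun i => ?_, V, hV, fun i => rfl⟩
  have h : (ampl ℕ (X i)).toLinearMap.IsSymmetric := fun f f' => by
    refine (lp.inner_eq_tsum _ _).trans (Eq.trans ?_ (lp.inner_eq_tsum _ _).symm)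
    refine tsum_congr fun j => ?_
    exact ContinuousLinearMap.isSelfAdjoint_iff_isSymmetric.1 (hsa i) (f j) (f' j)
  exact (ContinuousLinearMap.isSelfAdjoint_iff_isSymmetric.2 h).adjoint_conj V

/-- If the compression of `I ⊗ X` to the range of `V` is absolutely extreme, then the range of `V`
is invariant. -/
theorem inner_ampl_eq_zero_of_mem_absExtreme (hsa : ∀ i, IsSelfAdjoint (X i))
    {V : Hn n →L[ℂ] Copies ℕ H} (hV : Isometry V)
    (hY : (fun i => ContinuousLinearMap.adjoint V ∘L ampl ℕ (X i) ∘L V) ∈ absExtreme (ncHull X) n)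
    {u : Copies ℕ H} (hu : ‖u‖ = 1) (hVu : ∀ x, inner ℂ (V x) u = 0) (i : Fin g) (x : Hn n) :
    inner ℂ u (ampl ℕ (X i) (V x)) = 0 := by
  set Y : Tup g n := fun i => ContinuousLinearMap.adjoint V ∘L ampl ℕ (X i) ∘L V with hYdef
  have hVn : ∀ x, ‖V x‖ = ‖x‖ := (AddMonoidHomClass.isometry_iff_norm V).1 hV
  let V' : Hn (n + 1) →L[ℂ] Copies ℕ H :=
    LinearMap.toContinuousLinearMap (snocMap V.toLinearMap u)
  have hV' : Isometry V' := (AddMonoidHomClass.isometry_iff_norm V').2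
    fun x => norm_snocMap (V := V.toLinearMap) hVn hu hVu x
  let J : Hn n →L[ℂ] Hn (n + 1) := LinearMap.toContinuousLinearMap (castSuccMap n)
  have hJ : ∀ x, ‖J x‖ = ‖x‖ := norm_castSuccMap
  have hV'J : ∀ x, V' (J x) = V x := snocMap_castSuccMap V.toLinearMap u
  let Z : Tup g (n + 1) := fun i => ContinuousLinearMap.adjoint V' ∘L ampl ℕ (X i) ∘L V'
  have hZ : Z ∈ ncHull X (n + 1) := compression_mem_ncHull hsa hV'
  have hJne : J ≠ 0 := by
    intro h0
    have h1 := hJ (EuclideanSpace.single ⟨0, n.pos⟩ 1)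
    rw [h0] at h1
    simp at h1
  have hcv : ContinuousLinearMap.adjoint J ∘L J = ContinuousLinearMap.id ℂ (Hn n) :=
    ContinuousLinearMap.norm_map_iff_adjoint_comp_self J |>.1 hJ
  have hYZ : Y = combination (k := 1) (s := fun _ => n + 1) (fun _ => J) fun _ => Z := by
    funext i
    have hVJ : V = V' ∘L J := ContinuousLinearMap.ext fun x => (hV'J x).symm
    simp only [combination, Finset.univ_unique, Finset.sum_singleton, Z, hYdef]
    conv_lhs => rw [hVJ]
    rw [ContinuousLinearMap.adjoint_comp]
    rfl
  have hlt : n < n + 1 := PNat.lt_add_one_iff.2 le_rfl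
  -- `Y` is a one-term combination of `Z`. The sizes differ, which excludes the first alternative,
  -- and counting dimensions in the second forces `m = 1`.
  obtain ⟨h, -⟩ | ⟨-, m, A, hA, U, hU⟩ := hY.2 1 (fun _ => n + 1) (fun _ => J) (fun _ => Z)
    (fun _ => hZ) (fun _ => hJne) (by simpa [IsConvexWeight] using hcv) hYZ 0
  · exact absurd h hlt.ne'
  have hm : m = 1 := by
    have h1 := U.toLinearEquiv.finrank_eq
    rw [(WithLp.linearEquiv 2 ℂ (Hn n × Hn m)).finrank_eq, Module.finrank_prod] at h1
    simp only [finrank_euclideanSpace_fin, PNat.add_coe, PNat.one_coe] at h1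
    exact PNat.eq (by simpa using h1)
  subst hm
  have hU1 : ∀ x y, U (WithLp.toLp 2 (Y i x, A i y)) = Z i (U (WithLp.toLp 2 (x, y))) :=
    fun x y => hU i (WithLp.toLp 2 (x, y))
  have htr1 := trace_eq_add_of_unitary U (S := (Y i).toLinearMap) (T := (A i).toLinearMap)
    (R := (Z i).toLinearMap) hU1
  have htr2 := trace_eq_add_of_unitary U (S := (Y i).toLinearMap ∘ₗ (Y i).toLinearMap)
    (T := (A i).toLinearMap ∘ₗ (A i).toLinearMap) (R := (Z i).toLinearMap ∘ₗ (Z i).toLinearMap)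
    (fun x y => (hU1 (Y i x) (A i y)).trans (congrArg (Z i) (hU1 x y)))
  let bY := EuclideanSpace.basisFun (Fin n) ℂ
  let bZ : OrthonormalBasis (Fin (n + 1)) ℂ (Hn (n + 1)) := EuclideanSpace.basisFun (Fin (n + 1)) ℂ
  let bA : OrthonormalBasis (Fin 1) ℂ (Hn 1) := EuclideanSpace.basisFun (Fin 1) ℂ
  have hbV : ∀ a : Fin n, V' (bZ a.castSucc) = V (bY a) := by
    intro a
    rw [← hV'J]
    refine congrArg V' ((EuclideanSpace.basisFun_apply (Fin (n + 1)) ℂ a.castSucc).trans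
      ((castSuccMap_single a).symm.trans (congrArg (castSuccMap n) ?_)))
    exact (EuclideanSpace.basisFun_apply (Fin n) ℂ a).symm
  have hbu : V' (bZ (Fin.last n)) = u :=
    (congrArg V' (EuclideanSpace.basisFun_apply (Fin (n + 1)) ℂ (Fin.last n))).trans
      (snocMap_single_last V.toLinearMap u)
  have hZent : ∀ a c, inner ℂ (bZ c) (Z i (bZ a)) =
      inner ℂ (V' (bZ c)) (ampl ℕ (X i) (V' (bZ a))) := fun a c =>
    ContinuousLinearMap.adjoint_inner_right V' (bZ c) (ampl ℕ (X i) (V' (bZ a)))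
  have hYent : ∀ a c, inner ℂ (bY c) (Y i (bY a)) =
      inner ℂ (V (bY c)) (ampl ℕ (X i) (V (bY a))) := fun a c =>
    ContinuousLinearMap.adjoint_inner_right V (bY c) (ampl ℕ (X i) (V (bY a)))
  rw [trace_comp_self_eq_sum bY (hY.1.1 i), trace_comp_self_eq_sum bZ (hZ.1 i),
    trace_comp_self_eq_sum bA (hA.1 i)] at htr2
  rw [LinearMap.trace_eq_sum_inner _ bY, LinearMap.trace_eq_sum_inner _ bZ,
    LinearMap.trace_eq_sum_inner _ bA] at htr1
  simp only [ContinuousLinearMap.coe_coe, Fin.sum_univ_castSucc, hZent, hYent, hbV, hbu,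
    Finset.univ_unique, Finset.sum_singleton, add_right_inj, Finset.sum_add_distrib] at htr1 htr2
  norm_cast at htr2
  -- The first trace identifies the entry of `A i` with `⟪u, (I ⊗ X i) u⟫`. After this substitution
  -- the second trace says that the squared off-diagonal entries of `Z i` add up to zero.
  rw [← htr1] at htr2
  have h1 : ∑ a, ‖inner ℂ u (ampl ℕ (X i) (V (bY a)))‖ ^ 2 = 0 := by
    have h3 : 0 ≤ ∑ a, ‖inner ℂ u (ampl ℕ (X i) (V (bY a)))‖ ^ 2 := by positivity
    have h4 : 0 ≤ ∑ a, ‖inner ℂ (V (bY a)) (ampl ℕ (X i) u)‖ ^ 2 := by positivity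
    linarith
  have h2 : (innerSL ℂ u).toLinearMap ∘ₗ (ampl ℕ (X i)).toLinearMap ∘ₗ V.toLinearMap = 0 := by
    refine bY.toBasis.ext fun a => ?_
    have h3 := (Finset.sum_eq_zero_iff_of_nonneg fun a _ => by positivity).1 h1 a (Finset.mem_univ a)
    simpa using h3
  exact LinearMap.congr_fun h2 x

theorem absExtreme_ncHull_eq_empty (hsa : ∀ i, IsSelfAdjoint (X i)) (hred : NoFiniteDimReducing X)
    (n : ℕ+) : absExtreme (ncHull X) n = ∅ := by
  rw [Set.eq_empty_iff_forall_notMem]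
  intro Y hY
  obtain ⟨V, hV, hYV⟩ := hY.1.2
  obtain rfl : Y = fun i => ContinuousLinearMap.adjoint V ∘L ampl ℕ (X i) ∘L V := funext hYV
  have hinv : ∀ i x, ampl ℕ (X i) (V x) ∈ LinearMap.range V.toLinearMap := by
    intro i x
    -- The range is finite-dimensional, hence equal to its double orthogonal complement; it suffices
    -- to test against `u` orthogonal to it.
    rw [← Submodule.orthogonal_orthogonal (LinearMap.range V.toLinearMap),
      Submodule.mem_orthogonal]
    intro u hu
    by_cases hu0 : u = 0
    · rw [hu0, inner_zero_left]
    have hun : ‖u‖ ≠ 0 := norm_ne_zero_iff.2 hu0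
    have h1 := inner_ampl_eq_zero_of_mem_absExtreme hsa hV hY
      (u := ((‖u‖⁻¹ : ℝ) : ℂ) • u) (by simp [norm_smul, hun]) (fun y => by
        rw [inner_smul_right, Submodule.mem_orthogonal .. |>.1 hu (V y) ⟨y, rfl⟩, mul_zero]) i x
    rw [inner_smul_left, mul_eq_zero] at h1
    exact h1.resolve_left (by simpa using hu0)
  have hV0 : ∀ x, V x = 0 := by
    intro x
    refine lp.ext (funext fun j => ?_)
    -- Since `I ⊗ X i` acts coordinatewise, each coordinate of the invariant range is invariant
    -- under `X i`, and self-adjointness makes it reducing.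
    let W := LinearMap.range (coordₗ j ∘ₗ V.toLinearMap)
    have hWinv : ∀ i, ∀ w ∈ W, X i w ∈ W := by
      rintro i _ ⟨y, rfl⟩
      obtain ⟨z, hz⟩ := hinv i y
      exact ⟨z, congrArg (coordₗ j) hz⟩
    have hW : W = ⊥ := by
      refine hred W ⟨W.closed_of_finiteDimensional, fun i => ⟨hWinv i, fun w hw => ?_⟩⟩ inferInstance
      rw [Submodule.mem_orthogonal] at hw ⊢
      intro v hv
      have h1 := ContinuousLinearMap.isSelfAdjoint_iff_isSymmetric.1 (hsa i) v w
      exact h1.symm.trans (hw _ (hWinv i v hv))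
    have h1 : coordₗ j (V x) ∈ W := ⟨x, rfl⟩
    rw [hW, Submodule.mem_bot] at h1
    exact h1
  have h1 := (AddMonoidHomClass.isometry_iff_norm V).1 hV (EuclideanSpace.single ⟨0, n.pos⟩ 1)
  rw [hV0] at h1
  simp at h1

end Extreme

/-! ### Compact operators, normal functionals and Hilbert-Schmidt bounds. -/

theorem hasSum_sumElim {ι κ α : Type*} [AddCommMonoid α] [TopologicalSpace α] [ContinuousAdd α]
    {f : ι ⊕ κ → α} {a b : α} (hf : HasSum (fun j => f (.inl j)) a)
    (hg : HasSum (fun j => f (.inr j)) b) : HasSum f (a + b) := by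
  have h1 : HasSum (Sum.elim (fun j => f (.inl j)) fun _ : κ => 0) a := by
    rw [← (Sum.inl_injective (α := ι) (β := κ)).hasSum_iff]
    · exact hf
    · rintro (j | j) hj
      · exact absurd ⟨j, rfl⟩ hj
      · rfl
  have h2 : HasSum (Sum.elim (fun _ : ι => 0) fun j => f (.inr j)) b := by
    rw [← (Sum.inr_injective (α := ι) (β := κ)).hasSum_iff]
    · exact hg
    · rintro (j | j) hj
      · rfl
      · exact absurd ⟨j, rfl⟩ hj
  convert h1.add h2 using 1
  funext j
  cases j <;> simp

section Operators

variable {F : Type*} [NormedAddCommGroup F] [InnerProductSpace ℂ F]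

/-- Bessel's inequality. These finite-rank projections are the operators on which contractivity of a
functional is tested below. -/
theorem norm_sum_rankOne_le {ι : Type*} {h : ι → F} (hh : Orthonormal ℂ h) (s : Finset ι) :
    ‖∑ l ∈ s, InnerProductSpace.rankOne ℂ (h l) (h l)‖ ≤ 1 := by
  refine ContinuousLinearMap.opNorm_le_bound _ zero_le_one fun x => ?_
  rw [one_mul, ← sq_le_sq₀ (norm_nonneg _) (norm_nonneg _)]
  refine le_trans (le_of_eq ?_) (hh.sum_inner_products_le x (s := s))
  have h1 : (∑ l ∈ s, InnerProductSpace.rankOne ℂ (h l) (h l)) x =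
      ∑ l ∈ s, inner ℂ (h l) x • h l := by simp
  have h2 := hh.inner_sum (fun l => inner ℂ (h l) x) (fun l => inner ℂ (h l) x) s
  rw [inner_self_eq_norm_sq_to_K] at h2
  rw [h1]
  simp only [RCLike.conj_mul] at h2
  exact_mod_cast h2

theorem summable_inner_apply {ι : Type*} {u : ι → F} (hu : Summable fun j => ‖u j‖ ^ 2)
    (T : F →L[ℂ] F) : Summable fun j => inner ℂ (u j) (T (u j)) := by
  refine Summable.of_norm_bounded (hu.mul_left ‖T‖) fun j => ?_
  calc _ ≤ ‖u j‖ * ‖T (u j)‖ := norm_inner_le_norm _ _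
    _ ≤ ‖u j‖ * (‖T‖ * ‖u j‖) := by gcongr; exact T.le_opNorm _
    _ = ‖T‖ * ‖u j‖ ^ 2 := by ring

theorem norm_tsum_inner_apply_le {ι : Type*} {u : ι → F} {c : ℝ}
    (hu : HasSum (fun j => ‖u j‖ ^ 2) c) (T : F →L[ℂ] F) :
    ‖∑' j, inner ℂ (u j) (T (u j))‖ ≤ ‖T‖ * c := by
  refine tsum_of_norm_bounded (hu.mul_left ‖T‖) fun j => ?_
  calc _ ≤ ‖u j‖ * ‖T (u j)‖ := norm_inner_le_norm _ _
    _ ≤ ‖u j‖ * (‖T‖ * ‖u j‖) := by gcongr; exact T.le_opNorm _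
    _ = ‖T‖ * ‖u j‖ ^ 2 := by ring

/-- The positive normal functional `T ↦ ∑ j, ⟪u j, T (u j)⟫`. -/
noncomputable def vecFunctional {ι : Type*} (u : ι → F) (hu : Summable fun j => ‖u j‖ ^ 2) :
    (F →L[ℂ] F) →L[ℂ] ℂ :=
  LinearMap.mkContinuous
    { toFun := fun T => ∑' j, inner ℂ (u j) (T (u j))
      map_add' := fun S T => by
        simp only [add_apply, inner_add_right]
        exact (summable_inner_apply hu S).tsum_add (summable_inner_apply hu T)
      map_smul' := fun c T => by
        simp only [smul_apply, inner_smul_right, tsum_mul_left]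
        rfl }
    (∑' j, ‖u j‖ ^ 2) fun T => by
      rw [mul_comm]
      exact norm_tsum_inner_apply_le hu.hasSum T

theorem hasSum_vecFunctional {ι : Type*} {u : ι → F} (hu : Summable fun j => ‖u j‖ ^ 2)
    (T : F →L[ℂ] F) : HasSum (fun j => inner ℂ (u j) (T (u j))) (vecFunctional u hu T) :=
  (summable_inner_apply hu T).hasSum

theorem norm_vecFunctional_le {ι : Type*} {u : ι → F} {c : ℝ}
    (hu : HasSum (fun j => ‖u j‖ ^ 2) c) : ‖vecFunctional u hu.summable‖ ≤ c := by
  refine (LinearMap.mkContinuous_norm_le _ (tsum_nonneg fun j => by positivity) _).trans ?_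
  rw [hu.tsum_eq]

section Complete

variable [CompleteSpace F]

/-- A compact operator on a Hilbert space is a norm limit of operators of finite rank. -/
theorem mem_closure_span_rankOne {T : F →L[ℂ] F} (hT : IsCompactOperator T) :
    T ∈ closure (Submodule.span ℂ
      (Set.range fun p : F × F => InnerProductSpace.rankOne ℂ p.1 p.2) : Set (F →L[ℂ] F)) := by
  rw [Metric.mem_closure_iff]
  intro ε hε
  have hc : IsCompact (closure (T '' Metric.closedBall 0 1)) :=
    hT.isCompact_closure_image_closedBall (f := T.toLinearMap) 1
  obtain ⟨t, ht, hcover⟩ := Metric.totallyBounded_iff.1 hc.totallyBounded (ε / 2) (half_pos hε)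
  -- `U` is spanned by a finite `ε / 2`-net of the image of the unit ball, and compressing the range
  -- to `U` moves no such image by more than `ε / 2`.
  let U := Submodule.span ℂ t
  have : FiniteDimensional ℂ U := FiniteDimensional.span_of_finite ℂ ht
  refine ⟨U.starProjection ∘L T, ?_, ?_⟩
  · rw [(stdOrthonormalBasis ℂ U).starProjection_eq_sum_rankOne,
      ContinuousLinearMap.finsetSum_comp]
    refine Submodule.sum_mem _ fun i _ => Submodule.subset_span ?_
    rw [InnerProductSpace.rankOne_comp]
    exact ⟨(_, _), rfl⟩
  · rw [dist_eq_norm]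
    refine lt_of_le_of_lt (ContinuousLinearMap.opNorm_le_of_unit_norm (half_pos hε).le
      fun x hx => ?_) (half_lt_self hε)
    have hmem : T x ∈ closure (T '' Metric.closedBall 0 1) :=
      subset_closure ⟨x, by simp [hx], rfl⟩
    obtain ⟨y, hy, hxy⟩ := Set.mem_iUnion₂.1 (hcover hmem)
    have hyU : y ∈ U := Submodule.subset_span hy
    have h1 : (T - U.starProjection ∘L T) x = Uᗮ.starProjection (T x - y) := by
      rw [Submodule.starProjection_orthogonal']
      simp [Submodule.starProjection_eq_self_iff.2 hyU]
    rw [h1]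
    refine (Submodule.norm_starProjection_apply_le _ _).trans ?_
    rw [← dist_eq_norm]
    exact (Metric.mem_ball.1 hxy).le

/-- Functionals that agree on operators of rank one agree on compact operators. -/
theorem eq_of_eq_on_rankOne {φ ψ : (F →L[ℂ] F) →L[ℂ] ℂ}
    (h : ∀ x y, φ (InnerProductSpace.rankOne ℂ x y) = ψ (InnerProductSpace.rankOne ℂ x y))
    {T : F →L[ℂ] F} (hT : IsCompactOperator T) : φ T = ψ T :=
  ContinuousLinearMap.eqOn_closure_span (by rintro _ ⟨p, rfl⟩; exact h p.1 p.2)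
    (mem_closure_span_rankOne hT)

/-- The square root enters twice: as the root of a density operator, and as the root of the defect
`I - W* W` of a contraction. -/
theorem exists_sqrt {T : F →L[ℂ] F} (hT : T.IsPositive) :
    ∃ S : F →L[ℂ] F, IsSelfAdjoint S ∧ ∀ x y, inner ℂ (S x) (S y) = inner ℂ x (T y) := by
  have h0 : 0 ≤ T := (ContinuousLinearMap.nonneg_iff_isPositive T).2 hT
  have hS : IsSelfAdjoint (CFC.sqrt T) := (CFC.sqrt_nonneg T).isSelfAdjoint
  refine ⟨CFC.sqrt T, hS, fun x y => ?_⟩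
  have h1 : T y = CFC.sqrt T (CFC.sqrt T y) :=
    (DFunLike.congr_fun (CFC.sqrt_mul_sqrt_self T h0) y).symm
  rw [h1]
  exact ContinuousLinearMap.isSelfAdjoint_iff_isSymmetric.1 hS x (CFC.sqrt T y)

/-- The Hilbert-Schmidt norm of the adjoint is at most that of the operator. -/
theorem sum_norm_adjoint_sq_le {E ι : Type*} [NormedAddCommGroup E] [InnerProductSpace ℂ E]
    [CompleteSpace E] {Q : F →L[ℂ] E} {C : ℝ}
    (hQ : ∀ (h : Set F) (s : Finset h), Orthonormal ℂ ((↑) : h → F) →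
      ∑ l ∈ s, ‖Q l‖ ^ 2 ≤ C)
    {f : ι → E} (hf : Orthonormal ℂ f) (t : Finset ι) :
    ∑ j ∈ t, ‖ContinuousLinearMap.adjoint Q (f j)‖ ^ 2 ≤ C := by
  obtain ⟨w, b, hb⟩ := exists_hilbertBasis ℂ F
  have hw : Orthonormal ℂ ((↑) : w → F) := hb ▸ b.orthonormal
  have h1 : ∀ j, HasSum (fun l => ‖inner ℂ (f j) (Q (b l))‖ ^ 2)
      (‖ContinuousLinearMap.adjoint Q (f j)‖ ^ 2) := by
    intro j
    have h2 := b.hasSum_inner_mul_inner (ContinuousLinearMap.adjoint Q (f j))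
      (ContinuousLinearMap.adjoint Q (f j))
    have h3 := Complex.hasSum_re h2
    convert h3 using 1
    · funext l
      refine Eq.trans ?_ (inner_mul_symm_re_eq_norm (𝕜 := ℂ) _ _).symm
      rw [norm_mul, norm_inner_symm (b l), ← sq, ContinuousLinearMap.adjoint_inner_left]
    · exact (inner_self_eq_norm_sq (𝕜 := ℂ) _).symm
  -- Parseval in the basis `b` has expanded each term; exchanging the finite sums and applying
  -- Bessel to `f` leaves the hypothesis on `Q`.
  refine hasSum_le_of_sum_le (hasSum_sum fun j (_ : j ∈ t) => h1 j) fun s => ?_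
  rw [Finset.sum_comm' (t' := t) (s' := fun _ => s) (by tauto)]
  rw [Finset.sum_comm]
  refine (Finset.sum_le_sum fun l _ => hf.sum_inner_products_le (Q (b l))).trans ?_
  have h2 := hQ w s hw
  simpa [hb] using h2

/-- The density operator of a functional that is positive on operators of rank one. -/
theorem exists_density {φ : (F →L[ℂ] F) →L[ℂ] ℂ}
    (hφ : ∀ x, 0 ≤ (φ (InnerProductSpace.rankOne ℂ x x)).re ∧
      (φ (InnerProductSpace.rankOne ℂ x x)).im = 0) :
    ∃ S : F →L[ℂ] F, IsSelfAdjoint S ∧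
      ∀ x y, φ (InnerProductSpace.rankOne ℂ x y) = inner ℂ (S y) (S x) := by
  -- `(y, x) ↦ φ(|x⟩⟨y|)` is a bounded sesquilinear form. The operator `ρ` representing it is
  -- positive, and `S` is its square root.
  let B : F →L⋆[ℂ] F →L[ℂ] ℂ := LinearMap.mkContinuous₂
    (LinearMap.mk₂'ₛₗ (starRingEnd ℂ) (RingHom.id ℂ)
      (fun y x => φ (InnerProductSpace.rankOne ℂ x y)) (by simp) (by simp) (by simp) (by simp))
    ‖φ‖ fun y x => by
      refine (φ.le_opNorm _).trans (le_of_eq ?_)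
      rw [InnerProductSpace.norm_rankOne]
      ring
  let ρ := InnerProductSpace.continuousLinearMapOfBilin B
  have hρ : ∀ x y, inner ℂ (ρ y) x = φ (InnerProductSpace.rankOne ℂ x y) := fun x y =>
    InnerProductSpace.continuousLinearMapOfBilin_apply B y x
  have hpos : ρ.IsPositive := by
    rw [ContinuousLinearMap.isPositive_iff_complex]
    intro x
    rw [hρ]
    exact ⟨Complex.ext rfl (hφ x).2.symm, (hφ x).1⟩
  obtain ⟨S, hS, hSρ⟩ := exists_sqrt hpos
  refine ⟨S, hS, fun x y => ?_⟩
  rw [hSρ, ← hρ]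
  exact hpos.isSymmetric y x

end Complete

end Operators

/-! ### Closedness through weak-* compactness. -/

section Closed

variable {H : Type*} [NormedAddCommGroup H] [InnerProductSpace ℂ H] [CompleteSpace H]
  {g : ℕ} {n : ℕ+} {X : Fin g → H →L[ℂ] H}

/-- A contraction can be completed to an isometry without changing the compression, because zero is
in the finite interior. -/
theorem mem_ncHull_of_contraction (hsa : ∀ i, IsSelfAdjoint (X i)) (hzero : ZeroInFiniteInterior X)
    {ι : Type*} {w : ι → Hn n →L[ℂ] H} {Y : Tup g n}
    (hw : ∀ x (s : Finset ι), ∑ j ∈ s, ‖w j x‖ ^ 2 ≤ ‖x‖ ^ 2)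
    (hY : ∀ i x, HasSum (fun j => inner ℂ (w j x) (X i (w j x))) (inner ℂ x (Y i x))) :
    Y ∈ ncHull X n := by
  have hsum : ∀ x, Summable fun j => ‖w j x‖ ^ 2 := fun x =>
    summable_of_sum_le (fun j => by positivity) (hw x)
  obtain ⟨d, v, hv1, hv0⟩ := hzero
  let W : Hn n →L[ℂ] Copies ι H := LinearMap.toContinuousLinearMap
    (stack (fun j => (w j).toLinearMap) hsum)
  have hW : ∀ x, HasSum (fun j => ‖w j x‖ ^ 2) (‖W x‖ ^ 2) := fun x => hasSum_norm_sq_copies (W x)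
  have hWle : ∀ x, ‖W x‖ ^ 2 ≤ ‖x‖ ^ 2 := fun x => hasSum_le_of_sum_le (hW x) (hw x)
  let D : Hn n →L[ℂ] Hn n := ContinuousLinearMap.id ℂ (Hn n) - ContinuousLinearMap.adjoint W ∘L W
  have hDr : ∀ x, inner ℂ x (D x) = ((‖x‖ ^ 2 - ‖W x‖ ^ 2 : ℝ) : ℂ) := fun x => by
    simp only [D, sub_apply, ContinuousLinearMap.comp_apply, ContinuousLinearMap.id_apply,
      inner_sub_right, ContinuousLinearMap.adjoint_inner_right, inner_self_eq_norm_sq_to_K]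
    push_cast
    rfl
  have hD : ∀ x, inner ℂ (D x) x = ((‖x‖ ^ 2 - ‖W x‖ ^ 2 : ℝ) : ℂ) := fun x => by
    rw [← inner_conj_symm, hDr, Complex.conj_ofReal]
  have hDpos : D.IsPositive := by
    rw [ContinuousLinearMap.isPositive_iff_complex]
    intro x
    rw [hD]
    exact ⟨rfl, sub_nonneg.2 (hWle x)⟩
  obtain ⟨S, -, hS⟩ := exists_sqrt hDpos
  have hSn : ∀ x, ‖S x‖ ^ 2 = ‖x‖ ^ 2 - ‖W x‖ ^ 2 := fun x => by
    have h1 := hS x x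
    rw [hDr, inner_self_eq_norm_sq_to_K] at h1
    apply Complex.ofReal_injective
    rw [← h1, Complex.ofReal_pow]
    rfl
  let e := EuclideanSpace.basisFun (Fin n) ℂ
  -- The new components `x ↦ ⟪e_a, S x⟫ v_k` contribute `‖S x‖² = ‖x‖² - ‖W x‖²` to the norm, and
  -- nothing to the compression because `∑ ⟪v_k, X_i v_k⟫ = 0`.
  let w' : ι ⊕ (Fin n × Fin d) → Hn n →L[ℂ] H := Sum.elim w fun p =>
    (innerSL ℂ (e p.1) ∘L S).smulRight (v p.2)
  have hw' : ∀ p x, w' (.inr p) x = inner ℂ (e p.1) (S x) • v p.2 := fun p x => rfl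
  refine IsKraus.mem_ncHull (w := w') ⟨fun x => ?_, fun i x => ?_⟩ hsa
  · have h1 : ∑ p : Fin n × Fin d, ‖w' (.inr p) x‖ ^ 2 = ‖S x‖ ^ 2 := by
      simp only [hw', norm_smul, mul_pow]
      rw [Fintype.sum_prod_type]
      simp only [← Finset.mul_sum]
      have h2 : ∑ k, ‖v k‖ ^ 2 = 1 := by
        have := (hasSum_norm_sq_copies v).unique (hasSum_fintype _)
        rw [← this, hv1, one_pow]
      simp only [h2, mul_one]
      exact e.sum_sq_norm_inner_right (S x)
    have h2 := hasSum_sumElim (f := fun j => ‖w' j x‖ ^ 2) (hW x) (hasSum_fintype _)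
    rw [h1, hSn, add_sub_cancel] at h2
    exact h2
  · have h1 : ∑ p : Fin n × Fin d, inner ℂ (w' (.inr p) x) (X i (w' (.inr p) x)) = 0 := by
      simp only [hw', map_smul, inner_smul_left, inner_smul_right]
      rw [Fintype.sum_prod_type]
      simp only [← Finset.mul_sum]
      have h2 : ∑ k, inner ℂ (v k) (X i (v k)) = 0 := by
        have := (hasSum_inner_ampl (X i) v).unique (hasSum_fintype _)
        rw [← this, hv0]
      simp [h2]
    have h2 := hasSum_sumElim (f := fun j => inner ℂ (w' j x) (X i (w' j x))) (hY i x)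
      (hasSum_fintype _)
    rw [h1, add_zero] at h2
    exact h2

/-- The map `H ^ n → H` given by the linear combination with coefficients `c`. -/
noncomputable def contract (H : Type*) [NormedAddCommGroup H] [InnerProductSpace ℂ H] {n : ℕ}
    (c : EuclideanSpace ℂ (Fin n)) : PiLp 2 (fun _ : Fin n => H) →L[ℂ] H :=
  ∑ a, c a • PiLp.proj 2 (fun _ : Fin n => H) a

theorem contract_apply {H : Type*} [NormedAddCommGroup H] [InnerProductSpace ℂ H] {n : ℕ} (c : EuclideanSpace ℂ (Fin n)) (u : PiLp 2 fun _ : Fin n => H) :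
    contract H c u = ∑ a, c a • u a := by
  simp [contract]

/-- The operator `|c⟩⟨c| ⊗ T` on `H ^ n`. -/
noncomputable def inflate {n : ℕ} (c : EuclideanSpace ℂ (Fin n)) (T : H →L[ℂ] H) :
    PiLp 2 (fun _ : Fin n => H) →L[ℂ] PiLp 2 (fun _ : Fin n => H) :=
  ContinuousLinearMap.adjoint (contract H c) ∘L T ∘L contract H c

theorem inner_inflate {n : ℕ} (c : EuclideanSpace ℂ (Fin n)) (T : H →L[ℂ] H)
    (u : PiLp 2 fun _ : Fin n => H) :
    inner ℂ u (inflate c T u) = inner ℂ (contract H c u) (T (contract H c u)) := by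
  rw [inflate, ContinuousLinearMap.comp_apply, ContinuousLinearMap.adjoint_inner_right,
    ContinuousLinearMap.comp_apply]

theorem inflate_rankOne {n : ℕ} (c : EuclideanSpace ℂ (Fin n)) (x y : H) :
    inflate c (InnerProductSpace.rankOne ℂ x y) =
      InnerProductSpace.rankOne ℂ (ContinuousLinearMap.adjoint (contract H c) x)
        (ContinuousLinearMap.adjoint (contract H c) y) := by
  rw [inflate, InnerProductSpace.rankOne_comp, InnerProductSpace.comp_rankOne]

/-- The functionals on the operators on `H ^ n` that correspond to completely positive contractions
from the compact operators on `H` to the `n × n` matrices. -/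
def cpFunctionals (H : Type*) [NormedAddCommGroup H] [InnerProductSpace ℂ H] [CompleteSpace H]
    (n : ℕ) : Set (WeakDual ℂ (PiLp 2 (fun _ : Fin n => H) →L[ℂ] PiLp 2 (fun _ : Fin n => H))) :=
  WeakDual.toStrongDual ⁻¹' Metric.closedBall 0 n ∩
    ({φ | ∀ x, 0 ≤ (φ (InnerProductSpace.rankOne ℂ x x)).re ∧
      (φ (InnerProductSpace.rankOne ℂ x x)).im = 0} ∩
    {φ | ∀ (c : EuclideanSpace ℂ (Fin n)) (T : H →L[ℂ] H), ‖φ (inflate c T)‖ ≤ ‖T‖ * ‖c‖ ^ 2})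

/-- Banach-Alaoglu: the remaining conditions are closed conditions on single evaluations, so they
cut out a weak-* closed subset of the ball. -/
theorem isCompact_cpFunctionals (n : ℕ) : IsCompact (cpFunctionals H n) := by
  refine (WeakDual.isCompact_closedBall 0 (n : ℝ)).inter_right (IsClosed.inter ?_ ?_)
  · simp only [Set.ofPred_forall, Set.ofPred_and]
    refine isClosed_iInter fun x => IsClosed.inter ?_ ?_
    · exact isClosed_le continuous_const (Complex.continuous_re.comp (WeakDual.eval_continuous _))
    · exact isClosed_eq (Complex.continuous_im.comp (WeakDual.eval_continuous _)) continuous_const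
  · simp only [Set.ofPred_forall]
    refine isClosed_iInter fun c => isClosed_iInter fun T => ?_
    exact isClosed_le (WeakDual.eval_continuous _).norm continuous_const

theorem exists_cpFunctional_of_mem_ncHull {Y : Tup g n} (hY : Y ∈ ncHull X n) :
    ∃ φ ∈ cpFunctionals H n, ∀ i (c : Hn n), φ (inflate c (X i)) = inner ℂ c (Y i c) := by
  obtain ⟨w, hw⟩ := exists_isKraus_of_mem_ncHull hY
  -- `u j` lists the columns of `w j`, so that contracting it with `c` gives `w j c`. Its squared
  -- norms sum to `n`, the radius of the ball in `cpFunctionals`.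
  let u : ℕ → PiLp 2 (fun _ : Fin n => H) := fun j =>
    WithLp.toLp 2 fun a => w j (EuclideanSpace.single a 1)
  have hu : HasSum (fun j => ‖u j‖ ^ 2) (n : ℝ) := by
    have h1 := hasSum_sum (s := Finset.univ) fun (a : Fin n) _ =>
      hw.hasSum_norm_sq (EuclideanSpace.single a 1)
    simp only [PiLp.norm_single, norm_one, one_pow, Finset.sum_const, Finset.card_univ,
      Fintype.card_fin, nsmul_eq_mul, mul_one] at h1
    convert h1 using 2 with j
    exact PiLp.norm_sq_eq_of_L2 _ _
  have hcu : ∀ (c : Hn n) j, contract H c (u j) = w j c := by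
    intro c j
    rw [contract_apply]
    conv_rhs => rw [← (EuclideanSpace.basisFun (Fin n) ℂ).sum_repr c]
    simp [u]
  have hinf : ∀ c T, HasSum (fun j => inner ℂ (w j c) (T (w j c)))
      (vecFunctional u hu.summable (inflate c T)) := by
    intro c T
    have h1 := hasSum_vecFunctional hu.summable (inflate c T)
    simpa only [inner_inflate, hcu] using h1
  refine ⟨StrongDual.toWeakDual (vecFunctional u hu.summable), ⟨?_, fun x => ?_, fun c T => ?_⟩,
    fun i c => ?_⟩
  · exact mem_closedBall_zero_iff.2 (norm_vecFunctional_le hu)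
  · have h1 : HasSum (fun j => ((‖inner ℂ x (u j)‖ ^ 2 : ℝ) : ℂ))
        (vecFunctional u hu.summable (InnerProductSpace.rankOne ℂ x x)) := by
      convert hasSum_vecFunctional hu.summable (InnerProductSpace.rankOne ℂ x x) using 2 with j
      rw [InnerProductSpace.rankOne_apply, inner_smul_right, ← inner_conj_symm (u j) x,
        Complex.mul_conj, Complex.normSq_eq_norm_sq]
    exact ⟨(Complex.hasSum_re h1).nonneg fun j => sq_nonneg _,
      (Complex.hasSum_im h1).unique hasSum_zero⟩
  · refine le_of_eq_of_le (congrArg norm (hinf c T).tsum_eq.symm) ?_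
    exact norm_tsum_inner_apply_le (hw.hasSum_norm_sq c) T
  · exact (hinf c (X i)).unique (hw.hasSum_inner i c)

/-- On operators of rank one `φ` is given by the density `S²`; expanding in a Hilbert basis `f`
produces the components `c ↦ contract H c (S (f j))`. They represent `φ` on compact operators, in
particular on inflations of the `X i`, and form a contraction. -/
theorem mem_ncHull_of_cpFunctional (hsa : ∀ i, IsSelfAdjoint (X i))
    (hcpt : ∀ i, IsCompactOperator (X i)) (hzero : ZeroInFiniteInterior X) {Y : Tup g n}
    {φ : WeakDual ℂ (PiLp 2 (fun _ : Fin n => H) →L[ℂ] PiLp 2 (fun _ : Fin n => H))}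
    (hφ : φ ∈ cpFunctionals H n)
    (hY : ∀ i (c : Hn n), φ (inflate c (X i)) = inner ℂ c (Y i c)) : Y ∈ ncHull X n := by
  obtain ⟨-, hpos, hcontr⟩ := hφ
  obtain ⟨S, hS, hφS⟩ := exists_density (φ := WeakDual.toStrongDual φ) hpos
  replace hφS : ∀ x y, φ (InnerProductSpace.rankOne ℂ x y) = inner ℂ (S y) (S x) := hφS
  obtain ⟨B, f, -⟩ := exists_hilbertBasis ℂ (PiLp 2 fun _ : Fin n => H)
  let w : B → Hn n →L[ℂ] H := fun j => LinearMap.toContinuousLinearMap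
    { toFun := fun c => contract H c (S (f j))
      map_add' := fun c c' => by simp [contract_apply, add_smul, Finset.sum_add_distrib]
      map_smul' := fun r c => by simp [contract_apply, mul_smul, Finset.smul_sum] }
  let Q : Hn n → H →L[ℂ] PiLp 2 (fun _ : Fin n => H) := fun c =>
    S ∘L ContinuousLinearMap.adjoint (contract H c)
  have hQ : ∀ c j, ContinuousLinearMap.adjoint (Q c) (f j) = w j c := by
    intro c j
    simp only [Q, ContinuousLinearMap.adjoint_comp, ContinuousLinearMap.adjoint_adjoint,
      hS.adjoint_eq]
    rfl
  have hφQ : ∀ c x y, φ (inflate c (InnerProductSpace.rankOne ℂ x y)) =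
      inner ℂ (Q c y) (Q c x) := fun c x y => by
    rw [inflate_rankOne, hφS]
    rfl
  have hw : ∀ x (s : Finset B), ∑ j ∈ s, ‖w j x‖ ^ 2 ≤ ‖x‖ ^ 2 := by
    intro c s
    simp only [← hQ]
    -- Evaluating `φ` at inflated finite-rank projections bounds the Hilbert-Schmidt norm of `Q c`
    -- by `‖c‖`.
    refine sum_norm_adjoint_sq_le (fun h t hh => ?_) f.orthonormal s
    have h1 : φ (inflate c (∑ l ∈ t, InnerProductSpace.rankOne ℂ (l : H) (l : H))) =
        ((∑ l ∈ t, ‖Q c l‖ ^ 2 : ℝ) : ℂ) := by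
      have h2 : inflate c (∑ l ∈ t, InnerProductSpace.rankOne ℂ (l : H) (l : H)) =
          ∑ l ∈ t, inflate c (InnerProductSpace.rankOne ℂ (l : H) (l : H)) := by
        simp only [inflate, ContinuousLinearMap.finsetSum_comp, ContinuousLinearMap.comp_finsetSum]
      rw [h2, map_sum]
      simp only [hφQ, inner_self_eq_norm_sq_to_K]
      push_cast
      rfl
    have h2 := hcontr c (∑ l ∈ t, InnerProductSpace.rankOne ℂ (l : H) (l : H))
    rw [h1, Complex.norm_real] at h2
    refine (le_abs_self _).trans (h2.trans ?_)
    exact mul_le_of_le_one_left (sq_nonneg _) (norm_sum_rankOne_le hh t)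
  refine mem_ncHull_of_contraction hsa hzero hw fun i c => ?_
  have hsum : Summable fun j => ‖w j c‖ ^ 2 :=
    summable_of_sum_le (fun j => by positivity) (hw c)
  have h1 := hasSum_vecFunctional hsum (X i)
  rw [← hY]
  let ψ : (H →L[ℂ] H) →L[ℂ] ℂ := LinearMap.mkContinuous
    { toFun := fun T => φ (inflate c T)
      map_add' := fun T T' => by
        simp only [inflate, ContinuousLinearMap.add_comp, ContinuousLinearMap.comp_add, map_add]
      map_smul' := fun r T => by
        simp only [inflate, ContinuousLinearMap.smul_comp, ContinuousLinearMap.comp_smul, map_smul]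
        rfl }
    (‖c‖ ^ 2) fun T => by
      rw [mul_comm]
      exact hcontr c T
  have h2 : vecFunctional (fun j => w j c) hsum (X i) = ψ (X i) := by
    refine eq_of_eq_on_rankOne (fun x y => ?_) (hcpt i)
    refine (hasSum_vecFunctional hsum _).unique ?_
    have h3 : ψ (InnerProductSpace.rankOne ℂ x y) = inner ℂ (Q c y) (Q c x) := hφQ c x y
    rw [h3]
    -- Parseval for `f` gives agreement on operators of rank one.
    refine (f.hasSum_inner_mul_inner (Q c y) (Q c x)).congr_fun fun j => ?_
    rw [InnerProductSpace.rankOne_apply, inner_smul_right, ← hQ,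
      ContinuousLinearMap.adjoint_inner_left, ContinuousLinearMap.adjoint_inner_right]
  rw [h2] at h1
  exact h1

theorem isClosedNC_ncHull (hsa : ∀ i, IsSelfAdjoint (X i)) (hcpt : ∀ i, IsCompactOperator (X i))
    (hzero : ZeroInFiniteInterior X) : IsClosedNC (ncHull X) := by
  intro n
  have : CompactSpace (cpFunctionals H n) :=
    isCompact_iff_compactSpace.1 (isCompact_cpFunctionals n)
  -- `G` pairs each functional with the tuple it represents; projecting along the compact factor of
  -- functionals is a closed map.
  let G : Set (cpFunctionals H n × Tup g n) :=
    {p | ∀ i (c : Hn n), p.1.1 (inflate c (X i)) = inner ℂ c (p.2 i c)}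
  have hG : IsClosed G := by
    simp only [G, Set.ofPred_forall]
    refine isClosed_iInter fun i => isClosed_iInter fun c => isClosed_eq ?_ ?_
    · exact (WeakDual.eval_continuous _).comp (continuous_subtype_val.comp continuous_fst)
    · fun_prop
  have himage : ncHull X n = Prod.snd '' G := by
    ext Y
    constructor
    · intro hY
      obtain ⟨φ, hφ, h⟩ := exists_cpFunctional_of_mem_ncHull hY
      exact ⟨(⟨φ, hφ⟩, Y), h, rfl⟩
    · rintro ⟨⟨φ, Y'⟩, h, rfl⟩
      exact mem_ncHull_of_cpFunctional hsa hcpt hzero φ.2 h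
  rw [himage]
  exact isClosedMap_snd_of_compactSpace G hG

end Closed

end MatConv

theorem theorem1p2 {H : Type*} [NormedAddCommGroup H] [InnerProductSpace ℂ H] [CompleteSpace H]
    [TopologicalSpace.SeparableSpace H] (hH : ¬ FiniteDimensional ℂ H)
    (g : ℕ) (X : Fin g → H →L[ℂ] H)
    (hsa : ∀ i, IsSelfAdjoint (X i)) (hcpt : ∀ i, IsCompactOperator (X i))
    (hred : MatConv.NoFiniteDimReducing X) (hzero : MatConv.ZeroInFiniteInterior X) :
    MatConv.IsMatrixConvex (MatConv.ncHull X) ∧ MatConv.IsClosedNC (MatConv.ncHull X) ∧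
      MatConv.IsBoundedNC (MatConv.ncHull X) ∧
      ∀ n : ℕ+, MatConv.absExtreme (MatConv.ncHull X) n = ∅ :=
  ⟨MatConv.isMatrixConvex_ncHull hsa, MatConv.isClosedNC_ncHull hsa hcpt hzero,
    MatConv.isBoundedNC_ncHull, MatConv.absExtreme_ncHull_eq_empty hsa hred⟩
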